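/- Let $d_X,d_Y,d_Z\ge 1$ be integers, let $(X,Y,Z)$ take values in $\mathbb R^{d_X}\times\mathbb R^{d_Y}\times\mathbb R^{d_Z}=\mathbb R^{d_X+d_Y+d_Z}$, and fix a centre $c$ in this space. For $M\in(0,\infty]$ let $\mathcal E_{0,M}$ be the set of all distributions of $(X,Y,Z)$ that are absolutely continuous with respect to Lebesgue measure and whose support is contained in the open $\ell_\infty$ ball of radius $M$ around $c$ (no restriction if $M=\infty$). Let $\mathcal P_{0,M}\subseteq\mathcal E_{0,M}$ be the subset of those distributions under which $X$ and $Y$ are conditionally independent given $Z$, and let $\mathcal Q_{0,M}=\mathcal E_{0,M}\setminus\mathcal P_{0,M}$. A (potentially randomised) test at sample size $n$ is a measurable function $\psi_n:\mathbb R^{(d_X+d_Y+d_Z)n}\times[0,1]\to\{0,1\}$; for a distribution $P$ of $(X,Y,Z)$, write $\mathbb P_P(\psi_n=1)$ for the probability that $\psi_n\big((x_i,y_i,z_i)_{i\le n},U\big)=1$ when $(x_1,y_1,z_1),\dots,(x_n,y_n,z_n)$ are i.i.d. with distribution $P$ and $U$ is uniform on $[0,1]$ and independent of them. Theorem (No-free-lunch).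 Let $n\in\mathbb N$, $\alpha\in(0,1)$ and $M\in(0,\infty]$, and let $\psi_n$ be a potentially randomised test that has valid level $\alpha$ for the null hypothesis $\mathcal P_{0,M}$, that is, $$\sup_{P\in\mathcal P_{0,M}}\mathbb P_P(\psi_n=1)\le\alpha .$$ Then $\mathbb P_Q(\psi_n=1)\le\alpha$ for all $Q\in\mathcal Q_{0,M}$. Thus $\psi_n$ has no power against any alternative. -/

import Mathlib

open MeasureTheory ProbabilityTheory
open scoped ENNReal

noncomputable section

/-- The space `ℝ^dX × ℝ^dY × ℝ^dZ` of values of `(X, Y, Z)`. Its metric is the sup (`ℓ∞`)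
metric over all coordinates, and its `volume` is Lebesgue measure. -/
abbrev Obs (dX dY dZ : ℕ) : Type := (Fin dX → ℝ) × (Fin dY → ℝ) × (Fin dZ → ℝ)

/-- Distributions of `(X, Y, Z)` that are absolutely continuous with respect to Lebesgue
measure. -/
def acLaws (dX dY dZ : ℕ) : Set (ProbabilityMeasure (Obs dX dY dZ)) :=
  {P | (P : Measure (Obs dX dY dZ)) ≪ volume}

/-- Absolutely continuous distributions whose support is contained in the open `ℓ∞` ball of
radius `M ∈ (0, ∞]` around `c`. For `M = ∞` this is no restriction. -/
def acLawsInBall (dX dY dZ : ℕ) (c : Obs dX dY dZ) (M : ℝ≥0∞) :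
    Set (ProbabilityMeasure (Obs dX dY dZ)) :=
  {P ∈ acLaws dX dY dZ | (P : Measure (Obs dX dY dZ)).support ⊆ Metric.eball c M}

/-- `X` and `Y` are conditionally independent given `Z` when `(X, Y, Z)` has distribution `P`. -/
def IsCondIndepLaw {dX dY dZ : ℕ} (P : ProbabilityMeasure (Obs dX dY dZ)) : Prop :=
  CondIndepFun (MeasurableSpace.comap (fun v : Obs dX dY dZ => v.2.2) inferInstance)
    (Measurable.comap_le (measurable_snd.comp measurable_snd))
    (fun v : Obs dX dY dZ => v.1) (fun v : Obs dX dY dZ => v.2.1) (P : Measure (Obs dX dY dZ))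

/-- The null hypothesis: conditional independence holds. -/
def nullLaws (dX dY dZ : ℕ) (c : Obs dX dY dZ) (M : ℝ≥0∞) :
    Set (ProbabilityMeasure (Obs dX dY dZ)) :=
  {P ∈ acLawsInBall dX dY dZ c M | IsCondIndepLaw P}

/-- The alternative hypothesis: conditional independence fails. -/
def altLaws (dX dY dZ : ℕ) (c : Obs dX dY dZ) (M : ℝ≥0∞) :
    Set (ProbabilityMeasure (Obs dX dY dZ)) :=
  {Q ∈ acLawsInBall dX dY dZ c M | ¬ IsCondIndepLaw Q}

/-- A (possibly randomised) test at sample size `n`: a measurable `{0, 1}`-valued function of the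
sample and of a further argument in `[0, 1]`, which is fed with the randomisation variable. -/
structure RandomisedTest (dX dY dZ n : ℕ) where
  /-- the decision; the value `1` means rejection -/
  toFun : (Fin n → Obs dX dY dZ) × unitInterval → Fin 2
  measurable_toFun : Measurable toFun

/-- The probability that `ψ = 1` when the `n` observations are i.i.d. with distribution `P` and the
randomisation variable is uniform on `[0, 1]` and independent of the observations. -/
def RandomisedTest.rejectionProb {dX dY dZ n : ℕ} (ψ : RandomisedTest dX dY dZ n)
    (P : ProbabilityMeasure (Obs dX dY dZ)) : ℝ≥0∞ :=
  ((Measure.pi fun _ : Fin n => (P : Measure (Obs dX dY dZ))).prod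
    (volume : Measure unitInterval)) {w | ψ.toFun w = 1}

/-- `ψ` has valid level `α` for the null hypothesis `H`: its size over `H` is at most `α`. -/
def RandomisedTest.HasValidLevel {dX dY dZ n : ℕ} (ψ : RandomisedTest dX dY dZ n)
    (H : Set (ProbabilityMeasure (Obs dX dY dZ))) (α : ℝ) : Prop :=
  (⨆ P ∈ H, ψ.rejectionProb P) ≤ ENNReal.ofReal α

end

/-! Any absolutely continuous `Q` is imitated by random null laws. Draw `N` centres i.i.d. from `Q`
and mix the uniform laws on the `r`-balls around them. Almost surely the `Z`-parts of the centres
differ, so for small `r` the balls have disjoint `Z`-projections: `Z` then reveals the ball, and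
inside an `ℓ∞` ball `X` and `Y` are independent. The mixture is thus a null law
(`ballMixture_mem_nullLaws`), rejected with probability at most `α`.

Averaged over the centres, `n` observations that come from distinct balls are i.i.d. from `Q`
smoothed at scale `r`, and distinctness has probability `N.descFactorial n / N ^ n`. Hence this
factor times the smoothed rejection probability is at most `α` plus the probability of a bad
configuration (`descFactorial_mul_lintegral_le`). For fixed `N`, let `r → 0`: bad configurations
vanish (`tendsto_measure_compl_separatedCentres`) and smoothing disappears by differentiation of
measures and Fatou (`rejectionProb_le_liminf`). Then let `N → ∞`. -/

section Mixture

/-! ### Product densities and averages over random mixtures. -/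

variable {E : Type*} [MeasurableSpace E]

lemma lintegral_fin_prod_eq_prod {n : ℕ} (μ : Measure E) [SigmaFinite μ]
    (f : Fin n → E → ℝ≥0∞) (hf : ∀ i, Measurable (f i)) :
    ∫⁻ x, ∏ i, f i (x i) ∂(Measure.pi fun _ : Fin n => μ) = ∏ i, ∫⁻ x, f i x ∂μ := by
  induction n with
  | zero => simp
  | succ n ih =>
    have hprod : Measurable fun y : Fin n → E => ∏ i, f i.succ (y i) :=
      Finset.measurable_prod _ fun i _ => (hf i.succ).comp (measurable_pi_apply i)
    rw [← ((measurePreserving_piFinSuccAbove (fun _ : Fin (n + 1) => μ) 0).symm).lintegral_comp_emb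
      (MeasurableEquiv.measurableEmbedding _)]
    simp_rw [MeasurableEquiv.piFinSuccAbove_symm_apply, Fin.insertNthEquiv,
      Fin.prod_univ_succ, Fin.insertNth_zero, Equiv.coe_fn_mk, Fin.cons_succ, Fin.cons_zero]
    change ∫⁻ a : E × (Fin n → E), f 0 a.1 * ∏ i : Fin n, f i.succ (a.2 i)
      ∂(μ.prod (Measure.pi fun _ : Fin n => μ)) = _
    rw [lintegral_prod_mul (hf 0).aemeasurable hprod.aemeasurable,
      ih (fun i => f i.succ) fun i => hf i.succ]

lemma pi_withDensity {n : ℕ} (μ : Measure E) [SigmaFinite μ] (f : E → ℝ≥0∞) (hf : Measurable f)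
    [SigmaFinite (μ.withDensity f)] :
    (Measure.pi fun _ : Fin n => μ.withDensity f) =
      (Measure.pi fun _ : Fin n => μ).withDensity fun x => ∏ i, f (x i) := by
  refine (Measure.pi_eq fun s hs => ?_)
  rw [withDensity_apply _ (MeasurableSet.univ_pi hs),
    ← lintegral_indicator (MeasurableSet.univ_pi hs)]
  have key : ∀ x : Fin n → E, (Set.univ.pi s).indicator (fun x => ∏ i, f (x i)) x =
      ∏ i, (s i).indicator f (x i) := by
    intro x
    by_cases hx : x ∈ Set.univ.pi s
    · rw [Set.indicator_of_mem hx]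
      exact Finset.prod_congr rfl fun i _ => (Set.indicator_of_mem (hx i trivial) _).symm
    · rw [Set.indicator_of_notMem hx]
      obtain ⟨i, hi⟩ : ∃ i, x i ∉ s i := by simpa [Set.mem_pi] using hx
      exact (Finset.prod_eq_zero (Finset.mem_univ i) (Set.indicator_of_notMem hi _)).symm
  simp_rw [key]
  rw [lintegral_fin_prod_eq_prod μ (fun i => (s i).indicator f) fun i => hf.indicator (hs i)]
  exact Finset.prod_congr rfl fun i _ => by
    rw [lintegral_indicator (hs i), withDensity_apply _ (hs i)]

lemma lintegral_prod_comp_injective {n N : ℕ} (Q : Measure E) [IsProbabilityMeasure Q]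
    (f : Fin n → E → ℝ≥0∞) (hf : ∀ i, Measurable (f i)) (σ : Fin n → Fin N)
    (hσ : Function.Injective σ) :
    ∫⁻ ω, ∏ i, f i (ω (σ i)) ∂(Measure.pi fun _ : Fin N => Q) = ∏ i, ∫⁻ w, f i w ∂Q := by
  have hind : iIndepFun (fun (i : Fin N) (ω : Fin N → E) => ω i) (Measure.pi fun _ => Q) :=
    iIndepFun_pi (X := fun _ : Fin N => id) fun _ => aemeasurable_id
  have h2 := (hind.precomp hσ).comp f hf
  have h3 := lintegral_prod_eq_prod_lintegral_of_indepFun Finset.univ _ h2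
    (fun i => (hf i).comp (measurable_pi_apply (σ i)))
  refine h3.trans (Finset.prod_congr rfl fun i _ => ?_)
  exact (measurePreserving_eval (fun _ : Fin N => Q) (σ i)).lintegral_comp (hf i)

/-- Averaging `n`-fold products of random `N`-point mixtures dominates, up to the probability that
`n` draws out of `N` are distinct, the `n`-fold product of the averaged density. -/
lemma descFactorial_mul_lintegral_le_lintegral_mixture (μ Q : Measure E) [SigmaFinite μ]
    [IsProbabilityMeasure Q] (h : E → E → ℝ≥0∞) (hh : Measurable (Function.uncurry h))
    {n : ℕ} (g : (Fin n → E) → ℝ≥0∞) (hg : Measurable g) (N : ℕ) :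
    (N.descFactorial n : ℝ≥0∞) * (N : ℝ≥0∞)⁻¹ ^ n *
        ∫⁻ x, g x * ∏ i, ∫⁻ w, h w (x i) ∂Q ∂(Measure.pi fun _ : Fin n => μ) ≤
      ∫⁻ ω, ∫⁻ x, g x * ∏ i, ((N : ℝ≥0∞)⁻¹ * ∑ j, h (ω j) (x i))
        ∂(Measure.pi fun _ : Fin n => μ) ∂(Measure.pi fun _ : Fin N => Q) := by
  classical
  have hhm : ∀ (i : Fin n) (j : Fin N),
      Measurable fun p : (Fin N → E) × (Fin n → E) => h (p.1 j) (p.2 i) := by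
    intro i j
    have hp : Measurable fun p : (Fin N → E) × (Fin n → E) => (p.1 j, p.2 i) := by fun_prop
    exact hh.comp hp
  have hm : Measurable (Function.uncurry fun (ω : Fin N → E) (x : Fin n → E) =>
      g x * ∏ i, ((N : ℝ≥0∞)⁻¹ * ∑ j, h (ω j) (x i))) :=
    (hg.comp measurable_snd).mul (Finset.measurable_prod _ fun i _ =>
      (Finset.measurable_sum _ fun j _ => hhm i j).const_mul _)
  rw [lintegral_lintegral_swap hm.aemeasurable]
  have hm2 : Measurable fun x : Fin n → E => g x * ∏ i, ∫⁻ w, h w (x i) ∂Q :=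
    hg.mul (Finset.measurable_prod _ fun i _ =>
      (Measurable.lintegral_prod_left' hh).comp (measurable_pi_apply i))
  rw [← lintegral_const_mul _ hm2]
  refine lintegral_mono fun x => ?_
  have hmσ : ∀ σ : Fin n → Fin N, Measurable fun ω : Fin N → E => ∏ i, h (ω (σ i)) (x i) :=
    fun σ => Finset.measurable_prod _ fun i _ =>
      (hh.comp (measurable_id.prodMk measurable_const)).comp (measurable_pi_apply (σ i))
  -- `σ i` is the mixture component from which observation `i` is drawn.
  have hexp : ∀ ω : Fin N → E, ∏ i, ((N : ℝ≥0∞)⁻¹ * ∑ j, h (ω j) (x i)) =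
      (N : ℝ≥0∞)⁻¹ ^ n * ∑ σ : Fin n → Fin N, ∏ i, h (ω (σ i)) (x i) := by
    intro ω
    rw [Finset.prod_mul_distrib, Finset.prod_const, Finset.card_univ, Fintype.card_fin,
      Finset.prod_univ_sum, Fintype.piFinset_univ]
  have hcard : (N.descFactorial n : ℝ≥0∞) =
      ((Finset.univ.filter fun σ : Fin n → Fin N => Function.Injective σ).card : ℝ≥0∞) := by
    have h1 : Fintype.card (Fin n ↪ Fin N) = N.descFactorial n := by
      simp [Fintype.card_embedding_eq]
    rw [← h1, ← Fintype.card_congr (Equiv.subtypeInjectiveEquivEmbedding (Fin n) (Fin N)),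
      Fintype.card_subtype]
  simp_rw [hexp]
  rw [lintegral_const_mul _ ((Finset.measurable_sum _ fun σ _ => hmσ σ).const_mul _),
    lintegral_const_mul _ (Finset.measurable_sum _ fun σ _ => hmσ σ),
    lintegral_finsetSum _ fun σ _ => hmσ σ]
  calc (N.descFactorial n : ℝ≥0∞) * (N : ℝ≥0∞)⁻¹ ^ n * (g x * ∏ i, ∫⁻ w, h w (x i) ∂Q)
      = g x * ((N : ℝ≥0∞)⁻¹ ^ n *
          ∑ σ : Fin n → Fin N with Function.Injective σ, ∏ i, ∫⁻ w, h w (x i) ∂Q) := by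
        rw [Finset.sum_const, nsmul_eq_mul, hcard]; ring
    _ = g x * ((N : ℝ≥0∞)⁻¹ ^ n * ∑ σ : Fin n → Fin N with Function.Injective σ,
          ∫⁻ ω, ∏ i, h (ω (σ i)) (x i) ∂(Measure.pi fun _ : Fin N => Q)) := by
        congr 2
        refine Finset.sum_congr rfl fun σ hσ => ?_
        rw [lintegral_prod_comp_injective Q (fun i w => h w (x i))
          (fun i => hh.comp (measurable_id.prodMk measurable_const)) σ (Finset.mem_filter.1 hσ).2]
    -- Non-injective `σ` contribute nonnegative terms, which may be dropped.
    _ ≤ _ := by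
        gcongr
        exact Finset.filter_subset _ _

end Mixture

/-! ### Conditional independence of mixtures with separated third factors. -/

section CondIndep

variable {A B C ι : Type*} [MeasurableSpace A] [MeasurableSpace B] [MeasurableSpace C] [Fintype ι]

lemma measureReal_sum_prod_prod (a : ι → Measure A) (b : ι → Measure B) (ν : ι → Measure C)
    [∀ j, IsFiniteMeasure (a j)] [∀ j, IsFiniteMeasure (b j)] [∀ j, IsFiniteMeasure (ν j)]
    (s : Set A) (t : Set B) (u : Set C) :
    (∑ j, (a j).prod ((b j).prod (ν j))).real (s ×ˢ t ×ˢ u) =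
      ∑ j, (a j).real s * ((b j).real t * (ν j).real u) := by
  rw [measureReal_def, Measure.finsetSum_apply, ENNReal.toReal_sum fun j _ => measure_ne_top _ _]
  refine Finset.sum_congr rfl fun j _ => ?_
  rw [Measure.prod_prod, Measure.prod_prod, ENNReal.toReal_mul, ENNReal.toReal_mul]
  rfl

/-- On `S j` the third coordinate identifies component `j`, under which the first two are
independent. -/
lemma condExp_indicator_sum_prod_prod (a : ι → Measure A) (b : ι → Measure B) (ν : ι → Measure C)
    [∀ j, IsProbabilityMeasure (a j)] [∀ j, IsProbabilityMeasure (b j)]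
    [∀ j, IsFiniteMeasure (ν j)] (S : ι → Set C) (hS : ∀ j, MeasurableSet (S j))
    (hdisj : Pairwise (Function.onFun Disjoint S)) (hν : ∀ j, ν j (S j)ᶜ = 0)
    (s : Set A) (hs : MeasurableSet s) (t : Set B) (ht : MeasurableSet t) :
    (∑ j, (a j).prod ((b j).prod (ν j)))⟦s ×ˢ t ×ˢ Set.univ |
        MeasurableSpace.comap (fun v : A × B × C => v.2.2) inferInstance⟧
      =ᵐ[∑ j, (a j).prod ((b j).prod (ν j))]
      fun v => ∑ j, (S j).indicator (fun _ => (a j).real s * (b j).real t) v.2.2 := by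
  have hZ : Measurable fun v : A × B × C => v.2.2 := by fun_prop
  have hφ : Measurable fun z : C =>
      ∑ j, (S j).indicator (fun _ => (a j).real s * (b j).real t) z :=
    Finset.measurable_sum _ fun j _ => measurable_const.indicator (hS j)
  have hst : MeasurableSet (s ×ˢ t ×ˢ (Set.univ : Set C)) := hs.prod (ht.prod .univ)
  have hint : ∀ j, Integrable (fun v : A × B × C =>
      (S j).indicator (fun _ => (a j).real s * (b j).real t) v.2.2)
      (∑ j, (a j).prod ((b j).prod (ν j))) := fun j =>
    (integrable_const ((a j).real s * (b j).real t)).indicator (hZ (hS j))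
  refine (ae_eq_condExp_of_forall_setIntegral_eq hZ.comap_le
    ((integrable_const (1 : ℝ)).indicator hst)
    (fun _ _ _ => (integrable_finsetSum _ fun j _ => hint j).integrableOn) ?_ ?_).symm
  · rintro _ ⟨u, hu, rfl⟩ -
    rw [setIntegral_indicator hst, setIntegral_const,
      integral_finsetSum _ fun j _ => (hint j).integrableOn]
    have h1 : ((fun v : A × B × C => v.2.2) ⁻¹' u) ∩ s ×ˢ t ×ˢ Set.univ = s ×ˢ t ×ˢ u := by
      ext v; simp; tauto
    have h2 : ∀ j, ∫ v in (fun v : A × B × C => v.2.2) ⁻¹' u,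
        (S j).indicator (fun _ => (a j).real s * (b j).real t) v.2.2
          ∂(∑ j, (a j).prod ((b j).prod (ν j))) =
        (a j).real s * ((b j).real t * (ν j).real u) := by
      intro j
      have h3 : ((fun v : A × B × C => v.2.2) ⁻¹' u) ∩ ((fun v : A × B × C => v.2.2) ⁻¹' (S j)) =
          Set.univ ×ˢ Set.univ ×ˢ (u ∩ S j) := by
        ext v; simp
      change ∫ v in _, (((fun v : A × B × C => v.2.2) ⁻¹' (S j)).indicator
        (fun _ => (a j).real s * (b j).real t)) v ∂_ = _
      rw [setIntegral_indicator (hZ (hS j)), setIntegral_const, h3, measureReal_sum_prod_prod]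
      rw [Finset.sum_eq_single j]
      · rw [measureReal_def (ν j) (u ∩ S j), measure_inter_conull (hν j), ← measureReal_def]
        simp; ring
      · intro i _ hij
        have : ν i (u ∩ S j) = 0 := measure_mono_null
          (fun z hz hzi => Set.disjoint_left.1 (hdisj hij) hzi hz.2) (hν i)
        simp [measureReal_def, this]
      · simp
    simp_rw [h2]
    rw [h1, measureReal_sum_prod_prod]
    simp
  · exact (hφ.comp (comap_measurable _)).aestronglyMeasurable

/-- A finite mixture of product laws whose third factors live on disjoint sets makes the first two
coordinates conditionally independent given the third. -/
lemma condIndepFun_sum_prod_prod [StandardBorelSpace (A × B × C)]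
    (a : ι → Measure A) (b : ι → Measure B) (ν : ι → Measure C)
    [∀ j, IsProbabilityMeasure (a j)] [∀ j, IsProbabilityMeasure (b j)]
    [∀ j, IsFiniteMeasure (ν j)] (S : ι → Set C) (hS : ∀ j, MeasurableSet (S j))
    (hdisj : Pairwise (Function.onFun Disjoint S)) (hν : ∀ j, ν j (S j)ᶜ = 0)
    (μ : Measure (A × B × C)) [IsFiniteMeasure μ]
    (hμ : μ = ∑ j, (a j).prod ((b j).prod (ν j))) :
    CondIndepFun (MeasurableSpace.comap (fun v : A × B × C => v.2.2) inferInstance)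
      (Measurable.comap_le (measurable_snd.comp measurable_snd))
      (fun v : A × B × C => v.1) (fun v : A × B × C => v.2.1) μ := by
  subst hμ
  refine (condIndepFun_iff_condExp_inter_preimage_eq_mul (by fun_prop) (by fun_prop)).2
    fun s t hs ht => ?_
  have e1 : (fun v : A × B × C => v.1) ⁻¹' s = s ×ˢ Set.univ ×ˢ Set.univ := by ext v; simp
  have e2 : (fun v : A × B × C => v.2.1) ⁻¹' t = Set.univ ×ˢ t ×ˢ Set.univ := by ext v; simp
  have e3 : (fun v : A × B × C => v.1) ⁻¹' s ∩ (fun v : A × B × C => v.2.1) ⁻¹' t =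
      s ×ˢ t ×ˢ Set.univ := by ext v; simp
  rw [e3, e1, e2]
  filter_upwards [condExp_indicator_sum_prod_prod a b ν S hS hdisj hν s hs t ht,
    condExp_indicator_sum_prod_prod a b ν S hS hdisj hν s hs Set.univ .univ,
    condExp_indicator_sum_prod_prod a b ν S hS hdisj hν Set.univ .univ t ht] with v h1 h2 h3
  rw [h1, h2, h3]
  by_cases hv : ∃ j, v.2.2 ∈ S j
  · obtain ⟨j, hj⟩ := hv
    have hne : ∀ i ≠ j, v.2.2 ∉ S i := fun i hij hi => Set.disjoint_left.1 (hdisj hij) hi hj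
    have key : ∀ f : ι → ℝ, ∑ i, (S i).indicator (fun _ => f i) v.2.2 = f j := fun f => by
      rw [Finset.sum_eq_single j (fun i _ hij => Set.indicator_of_notMem (hne i hij) _) (by simp),
        Set.indicator_of_mem hj]
    simp only [key]
    simp
  -- Off all `S j` both sides are the empty sum, so no null set has to be discarded.
  · push Not at hv
    simp [Set.indicator_of_notMem (hv _)]

end CondIndep

/-! ### Mixtures of uniform laws on balls, and separated centres. -/

section Smoothing

open Filter Topology Metric

instance isAddHaarMeasure_volume_obs (dX dY dZ : ℕ) :
    (volume : Measure (Obs dX dY dZ)).IsAddHaarMeasure := by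
  have key : ∀ {E F : Type} [NormedAddCommGroup E] [NormedAddCommGroup F] [MeasureSpace E]
      [MeasureSpace F] [BorelSpace E] [BorelSpace F] [SFinite (volume : Measure E)]
      [SFinite (volume : Measure F)] [(volume : Measure E).IsAddHaarMeasure]
      [(volume : Measure F).IsAddHaarMeasure], (volume : Measure (E × F)).IsAddHaarMeasure :=
    fun {E F} _ _ _ _ _ _ _ _ _ _ =>
      Measure.prod.instIsAddHaarMeasure (volume : Measure E) (volume : Measure F)
  exact @key _ _ _ _ _ _ _ _ _ _ _ key

/-- In `ℝ≥0∞` the inverse of a product splits as soon as one factor is neither `0` nor `∞`. -/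
lemma cond_prod {E F : Type*} [MeasurableSpace E] [MeasurableSpace F] (μ : Measure E)
    (ν : Measure F) [SigmaFinite μ] [SigmaFinite ν] (s : Set E) (t : Set F) (hs0 : μ s ≠ 0)
    (hs : μ s ≠ ∞) :
    (μ.prod ν)[|s ×ˢ t] = μ[|s].prod ν[|t] := by
  rw [ProbabilityTheory.cond, ProbabilityTheory.cond, ProbabilityTheory.cond, Measure.prod_smul_left, Measure.prod_smul_right, Measure.prod_restrict,
    Measure.prod_prod, smul_smul, ENNReal.mul_inv (Or.inl hs0) (Or.inl hs)]

lemma isProbabilityMeasure_cond_closedBall {E : Type*} [NormedAddCommGroup E] [NormedSpace ℝ E]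
    [FiniteDimensional ℝ E] [MeasurableSpace E] [BorelSpace E]
    (μ : Measure E) [μ.IsAddHaarMeasure] (w : E) {r : ℝ} (hr : 0 < r) :
    IsProbabilityMeasure μ[|closedBall w r] :=
  cond_isProbabilityMeasure_of_finite (measure_closedBall_pos _ w hr).ne'
    measure_closedBall_lt_top.ne

variable {dX dY dZ n N : ℕ}

/-- The density of the uniform law on the closed ball of radius `r` around `w`. -/
noncomputable def ballDensity (r : ℝ) (w x : Obs dX dY dZ) : ℝ≥0∞ :=
  (closedBall w r).indicator (fun _ => (volume (closedBall (0 : Obs dX dY dZ) r))⁻¹) x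

/-- The equally weighted mixture of the uniform laws on the closed balls of radius `r` around the
points of `ω`. -/
noncomputable def ballMixture (r : ℝ) (ω : Fin N → Obs dX dY dZ) : Measure (Obs dX dY dZ) :=
  ∑ j, (N : ℝ≥0∞)⁻¹ • (volume : Measure (Obs dX dY dZ))[|closedBall (ω j) r]

lemma measurable_ballDensity (r : ℝ) :
    Measurable (Function.uncurry (ballDensity (dX := dX) (dY := dY) (dZ := dZ) r)) := by
  have hS : MeasurableSet {p : Obs dX dY dZ × Obs dX dY dZ | dist p.2 p.1 ≤ r} :=
    (isClosed_le (by fun_prop) continuous_const).measurableSet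
  exact (measurable_const (a := (volume (closedBall (0 : Obs dX dY dZ) r))⁻¹)).indicator hS

/-- By symmetry of the distance, averaging over the centre yields the quotient to which
differentiation of measures applies. -/
lemma lintegral_ballDensity (Q : Measure (Obs dX dY dZ)) (r : ℝ) (x : Obs dX dY dZ) :
    ∫⁻ w, ballDensity r w x ∂Q = Q (closedBall x r) / volume (closedBall x r) := by
  have : ∀ w, ballDensity r w x =
      (closedBall x r).indicator (fun _ => (volume (closedBall (0 : Obs dX dY dZ) r))⁻¹) w := by
    intro w
    simp only [ballDensity, Set.indicator, mem_closedBall, dist_comm]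
  simp_rw [this]
  rw [lintegral_indicator_const measurableSet_closedBall, ← Measure.addHaar_closedBall_center _ x,
    ENNReal.div_eq_inv_mul]

lemma ballMixture_eq_withDensity (r : ℝ) (ω : Fin N → Obs dX dY dZ) :
    ballMixture r ω = volume.withDensity
      fun x => (N : ℝ≥0∞)⁻¹ * ∑ j, ballDensity r (ω j) x := by
  have hm : ∀ j, Measurable fun x => ballDensity r (ω j) x := fun j =>
    (measurable_ballDensity r).of_uncurry_left
  ext s hs
  rw [withDensity_apply _ hs, lintegral_const_mul _ (Finset.measurable_sum _ fun j _ => hm j),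
    lintegral_finsetSum _ fun j _ => hm j, ballMixture, Measure.finsetSum_apply, Finset.mul_sum]
  refine Finset.sum_congr rfl fun j _ => ?_
  simp only [ballDensity]
  rw [lintegral_indicator_const measurableSet_closedBall, Measure.smul_apply, smul_eq_mul,
    cond_apply measurableSet_closedBall, Measure.addHaar_closedBall_center,
    Measure.restrict_apply measurableSet_closedBall]

lemma isProbabilityMeasure_ballMixture (hN : 0 < N) {r : ℝ} (hr : 0 < r)
    (ω : Fin N → Obs dX dY dZ) : IsProbabilityMeasure (ballMixture r ω) := by
  have := fun j => isProbabilityMeasure_cond_closedBall volume (ω j) hr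
  constructor
  simp [ballMixture, Measure.finsetSum_apply,
    ENNReal.mul_inv_cancel (Nat.cast_ne_zero.2 hN.ne') (ENNReal.natCast_ne_top N)]

/-- Sup-metric balls are products of balls. The weight sits on the third factor so that the first
two stay probability measures. -/
lemma ballMixture_eq_sum_prod_prod {r : ℝ} (hr : 0 < r) (ω : Fin N → Obs dX dY dZ) :
    ballMixture r ω = ∑ j, volume[|closedBall (ω j).1 r].prod
      (volume[|closedBall (ω j).2.1 r].prod
        ((N : ℝ≥0∞)⁻¹ • volume[|closedBall (ω j).2.2 r])) := by
  refine Finset.sum_congr rfl fun j _ => ?_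
  rw [Measure.prod_smul_right, Measure.prod_smul_right,
    ← cond_prod _ _ _ _ (measure_closedBall_pos _ _ hr).ne' measure_closedBall_lt_top.ne,
    ← cond_prod _ _ _ _ (measure_closedBall_pos _ _ hr).ne' measure_closedBall_lt_top.ne,
    closedBall_prod_same, closedBall_prod_same]
  rfl

/-- The configurations of centres for which the balls of radius `r` lie in the ball of radius `M`
around `c` and have pairwise disjoint projections to the last factor. -/
def separatedCentres (c : Obs dX dY dZ) (M : ℝ≥0∞) (N : ℕ) (r : ℝ) :
    Set (Fin N → Obs dX dY dZ) :=
  {ω | (∀ i j, i ≠ j → r + r < dist (ω i).2.2 (ω j).2.2) ∧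
    ∀ j, edist (ω j) c + ENNReal.ofReal r < M}

lemma measurableSet_separatedCentres (c : Obs dX dY dZ) (M : ℝ≥0∞) (N : ℕ) (r : ℝ) :
    MeasurableSet (separatedCentres c M N r) := by
  refine MeasurableSet.inter ?_ ?_
  · refine measurableSet_setOfPred.2 ?_
    refine Measurable.forall fun i => Measurable.forall fun j => Measurable.imp measurable_const ?_
    exact measurableSet_setOfPred.1 (isOpen_lt continuous_const (by fun_prop)).measurableSet
  · refine measurableSet_setOfPred.2 (Measurable.forall fun j => measurableSet_setOfPred.1 ?_)
    exact measurableSet_lt (by fun_prop) measurable_const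

lemma ballMixture_mem_nullLaws (c : Obs dX dY dZ) (M : ℝ≥0∞) (hN : 0 < N) {r : ℝ} (hr : 0 < r)
    (ω : Fin N → Obs dX dY dZ) (hω : ω ∈ separatedCentres c M N r) :
    (⟨ballMixture r ω, isProbabilityMeasure_ballMixture hN hr ω⟩ :
      ProbabilityMeasure (Obs dX dY dZ)) ∈ nullLaws dX dY dZ c M := by
  have := isProbabilityMeasure_ballMixture hN hr ω
  have hX := fun j => isProbabilityMeasure_cond_closedBall volume (ω j).1 hr
  have hY := fun j => isProbabilityMeasure_cond_closedBall volume (ω j).2.1 hr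
  have hZ := fun j => isProbabilityMeasure_cond_closedBall volume (ω j).2.2 hr
  have hN0 : (N : ℝ≥0∞)⁻¹ ≠ ∞ := ENNReal.inv_ne_top.2 (Nat.cast_ne_zero.2 hN.ne')
  have hfin : ∀ j, IsFiniteMeasure ((N : ℝ≥0∞)⁻¹ •
      (volume : Measure (Fin dZ → ℝ))[|closedBall (ω j).2.2 r]) := fun j =>
    Measure.smul_finite _ hN0
  refine ⟨⟨?_, ?_⟩, ?_⟩
  · change ballMixture r ω ≪ volume
    rw [ballMixture_eq_withDensity]
    exact withDensity_absolutelyContinuous _ _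
  · refine (Measure.support_subset_of_isClosed
      (isClosed_iUnion_of_finite fun j => isClosed_closedBall (x := ω j) (ε := r)) ?_).trans
      (Set.iUnion_subset fun j x hx => ?_)
    · rw [mem_ae_iff]
      change ballMixture r ω _ = 0
      rw [ballMixture, Measure.finsetSum_apply]
      refine Finset.sum_eq_zero fun j _ => ?_
      rw [Measure.smul_apply, cond_apply measurableSet_closedBall,
        ← Set.sdiff_eq, Set.sdiff_eq_empty.2 (Set.subset_iUnion (fun i => closedBall (ω i) r) j)]
      simp
    · rw [mem_eball]
      calc edist x c ≤ edist (ω j) c + edist x (ω j) := by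
            rw [add_comm]; exact edist_triangle _ _ _
        _ ≤ edist (ω j) c + ENNReal.ofReal r := by
            gcongr
            rw [edist_dist]
            exact ENNReal.ofReal_le_ofReal hx
        _ < M := hω.2 j
  · have key := condIndepFun_sum_prod_prod
      (fun j => (volume : Measure (Fin dX → ℝ))[|closedBall (ω j).1 r])
      (fun j => (volume : Measure (Fin dY → ℝ))[|closedBall (ω j).2.1 r])
      (fun j => (N : ℝ≥0∞)⁻¹ • (volume : Measure (Fin dZ → ℝ))[|closedBall (ω j).2.2 r])
      (fun j => closedBall (ω j).2.2 r) (fun j => measurableSet_closedBall)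
      (fun i j hij => closedBall_disjoint_closedBall (hω.1 i j hij))
      (fun j => by simp [cond_apply measurableSet_closedBall])
      (ballMixture r ω) (ballMixture_eq_sum_prod_prod hr ω)
    exact key

instance isAddHaarMeasure_volume_pi_obs (dX dY dZ N : ℕ) :
    (volume : Measure (Fin N → Obs dX dY dZ)).IsAddHaarMeasure := by
  have key : ∀ {E : Type} [NormedAddCommGroup E] [NormedSpace ℝ E] [FiniteDimensional ℝ E]
      [MeasureSpace E] [BorelSpace E] [(volume : Measure E).IsAddHaarMeasure],
      (volume : Measure (Fin N → E)).IsAddHaarMeasure := fun {E} _ _ _ _ _ _ => inferInstance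
  exact @key _ _ _ _ _ _ (isAddHaarMeasure_volume_obs dX dY dZ)

lemma ae_coordinates_ne (hZ : 0 < dZ) {i j : Fin N} (hij : i ≠ j) :
    ∀ᵐ ω : Fin N → Obs dX dY dZ, (ω i).2.2 ≠ (ω j).2.2 := by
  let L : (Fin N → Obs dX dY dZ) →ₗ[ℝ] (Fin dZ → ℝ) :=
    (LinearMap.snd ℝ (Fin dY → ℝ) (Fin dZ → ℝ)) ∘ₗ
      (LinearMap.snd ℝ (Fin dX → ℝ) ((Fin dY → ℝ) × (Fin dZ → ℝ))) ∘ₗ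
      (LinearMap.proj (R := ℝ) (φ := fun _ : Fin N => Obs dX dY dZ) i -
        LinearMap.proj (R := ℝ) (φ := fun _ : Fin N => Obs dX dY dZ) j)
  have hL : ∀ ω, L ω = (ω i).2.2 - (ω j).2.2 := fun ω => rfl
  have hne : LinearMap.ker L ≠ ⊤ := by
    intro h
    -- `L` sends this vector to the constant `1`, which is nonzero because `dZ > 0`; so the kernel
    -- is a proper, hence null, subspace.
    have h1 : (Pi.single i (0, 0, 1) : Fin N → Obs dX dY dZ) ∈ LinearMap.ker L :=
      h ▸ Submodule.mem_top
    rw [LinearMap.mem_ker, hL, Pi.single_eq_same, Pi.single_eq_of_ne hij.symm] at h1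
    have := congrFun h1 ⟨0, hZ⟩
    simp at this
  refine measure_mono_null (fun ω hω => ?_) (Measure.addHaar_submodule volume _ hne)
  have h2 : (ω i).2.2 = (ω j).2.2 := not_not.1 hω
  exact (LinearMap.mem_ker.2 ((hL ω).trans (sub_eq_zero.2 h2)) : ω ∈ LinearMap.ker L)

lemma pi_absolutelyContinuous {Q : Measure (Obs dX dY dZ)} [IsProbabilityMeasure Q]
    (hQ : Q ≪ volume) : (Measure.pi fun _ : Fin N => Q) ≪ volume := by
  have hf : Measurable (Q.rnDeriv volume) := Measure.measurable_rnDeriv _ _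
  have hd := Measure.withDensity_rnDeriv_eq Q volume hQ
  have : IsProbabilityMeasure (volume.withDensity (Q.rnDeriv volume)) := by rwa [hd]
  conv_lhs => rw [← hd]
  rw [pi_withDensity volume _ hf]
  exact withDensity_absolutelyContinuous _ _

lemma tendsto_measure_compl_separatedCentres (hZ : 0 < dZ) (c : Obs dX dY dZ) (M : ℝ≥0∞)
    {Q : Measure (Obs dX dY dZ)} [IsProbabilityMeasure Q] (hQ : Q ≪ volume)
    (hsupp : Q.support ⊆ eball c M) (N : ℕ) {r : ℕ → ℝ} (hr : Tendsto r atTop (𝓝 0)) :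
    Tendsto (fun k => (Measure.pi fun _ : Fin N => Q) (separatedCentres c M N (r k))ᶜ)
      atTop (𝓝 0) := by
  rw [← measure_empty (μ := Measure.pi fun _ : Fin N => Q)]
  refine tendsto_measure_of_ae_tendsto_indicator_of_isFiniteMeasure atTop MeasurableSet.empty
    (fun k => (measurableSet_separatedCentres c M N _).compl) ?_
  have h1 : ∀ᵐ ω ∂(Measure.pi fun _ : Fin N => Q), ∀ i j, i ≠ j → (ω i).2.2 ≠ (ω j).2.2 := by
    refine ae_all_iff.2 fun i => ae_all_iff.2 fun j => ?_
    by_cases hij : i = j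
    · exact ae_of_all _ fun ω h => absurd hij h
    · filter_upwards [(pi_absolutelyContinuous hQ).ae_le (ae_coordinates_ne hZ hij)] with ω h _
      exact h
  have h2 : ∀ᵐ ω ∂(Measure.pi fun _ : Fin N => Q), ∀ j, ω j ∈ eball c M := by
    refine ae_all_iff.2 fun j => ?_
    have h3 : ∀ᵐ w ∂Q, w ∈ eball c M :=
      measure_mono_null (Set.compl_subset_compl.2 hsupp) Measure.measure_compl_support
    exact (Measure.tendsto_eval_ae_ae (μ := fun _ : Fin N => Q) (i := j)).eventually h3
  filter_upwards [h1, h2] with ω hω1 hω2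
  -- At radius `0` all the finitely many strict inequalities hold, so they persist for small radii.
  have h4 : ∀ᶠ k in atTop, ω ∈ separatedCentres c M N (r k) := by
    refine Filter.Eventually.and ?_ ?_
    · refine eventually_all.2 fun i => eventually_all.2 fun j => ?_
      by_cases hij : i = j
      · exact Eventually.of_forall fun k h => absurd hij h
      · have : Tendsto (fun k => r k + r k) atTop (𝓝 0) := by simpa using hr.add hr
        exact (this.eventually_lt_const (dist_pos.2 (hω1 i j hij))).mono fun k h _ => h
    · refine eventually_all.2 fun j => ?_
      have : Tendsto (fun k => edist (ω j) c + ENNReal.ofReal (r k)) atTop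
          (𝓝 (edist (ω j) c + ENNReal.ofReal 0)) :=
        tendsto_const_nhds.add (ENNReal.tendsto_ofReal hr)
      rw [ENNReal.ofReal_zero, add_zero] at this
      exact this.eventually_lt_const (hω2 j)
  filter_upwards [h4] with k hk
  simpa using hk

end Smoothing

/-! ### Comparison of rejection probabilities and the limits in `r` and `N`. -/

section Power

open Filter Topology Metric

variable {dX dY dZ n : ℕ}

/-- The conditional probability of rejection given the observations. -/
noncomputable def RandomisedTest.condRejectionProb (ψ : RandomisedTest dX dY dZ n)
    (x : Fin n → Obs dX dY dZ) : ℝ≥0∞ :=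
  (volume : Measure unitInterval) {u | ψ.toFun (x, u) = 1}

lemma RandomisedTest.measurableSet_rejection (ψ : RandomisedTest dX dY dZ n) :
    MeasurableSet {w | ψ.toFun w = 1} :=
  ψ.measurable_toFun (measurableSet_singleton 1)

lemma RandomisedTest.measurable_condRejectionProb (ψ : RandomisedTest dX dY dZ n) :
    Measurable ψ.condRejectionProb :=
  measurable_measure_prodMk_left ψ.measurableSet_rejection

lemma RandomisedTest.rejectionProb_eq_lintegral (ψ : RandomisedTest dX dY dZ n)
    (P : ProbabilityMeasure (Obs dX dY dZ)) :
    ψ.rejectionProb P =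
      ∫⁻ x, ψ.condRejectionProb x ∂(Measure.pi fun _ : Fin n => (P : Measure (Obs dX dY dZ))) :=
  Measure.prod_apply ψ.measurableSet_rejection

lemma RandomisedTest.rejectionProb_le_one (ψ : RandomisedTest dX dY dZ n)
    (P : ProbabilityMeasure (Obs dX dY dZ)) : ψ.rejectionProb P ≤ 1 :=
  prob_le_one

lemma lintegral_pi_withDensity {E : Type*} [MeasurableSpace E] (μ : Measure E) [SigmaFinite μ]
    (f : E → ℝ≥0∞) (hf : Measurable f) [SigmaFinite (μ.withDensity f)] (g : (Fin n → E) → ℝ≥0∞)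
    (hg : Measurable g) :
    ∫⁻ x, g x ∂(Measure.pi fun _ : Fin n => μ.withDensity f) =
      ∫⁻ x, g x * ∏ i, f (x i) ∂(Measure.pi fun _ : Fin n => μ) := by
  have hm : Measurable fun x : Fin n → E => ∏ i, f (x i) :=
    Finset.measurable_prod _ fun i _ => hf.comp (measurable_pi_apply i)
  rw [pi_withDensity μ f hf, lintegral_withDensity_eq_lintegral_mul _ hm hg]
  simp only [Pi.mul_apply, mul_comm]

lemma measurable_measure_closedBall_div (Q : Measure (Obs dX dY dZ)) [IsProbabilityMeasure Q]
    (r : ℝ) : Measurable fun x => Q (closedBall x r) / volume (closedBall x r) := by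
  simp_rw [← lintegral_ballDensity]
  exact (measurable_ballDensity r).lintegral_prod_left'

lemma descFactorial_mul_lintegral_le (c : Obs dX dY dZ) (M : ℝ≥0∞) (ψ : RandomisedTest dX dY dZ n)
    {a : ℝ≥0∞} (hψ : ∀ P ∈ nullLaws dX dY dZ c M, ψ.rejectionProb P ≤ a)
    (Q : Measure (Obs dX dY dZ)) [IsProbabilityMeasure Q] {N : ℕ} (hN : 0 < N) {r : ℝ}
    (hr : 0 < r) :
    (N.descFactorial n : ℝ≥0∞) * (N : ℝ≥0∞)⁻¹ ^ n *
        ∫⁻ x, ψ.condRejectionProb x * ∏ i, (Q (closedBall (x i) r) / volume (closedBall (x i) r))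
          ∂(Measure.pi fun _ : Fin n => volume) ≤
      a + (Measure.pi fun _ : Fin N => Q) (separatedCentres c M N r)ᶜ := by
  have h1 := descFactorial_mul_lintegral_le_lintegral_mixture volume Q (ballDensity r)
    (measurable_ballDensity r) ψ.condRejectionProb ψ.measurable_condRejectionProb N
  simp_rw [lintegral_ballDensity] at h1
  refine h1.trans ?_
  have hS := (measurableSet_separatedCentres c M N r).compl
  calc _ ≤ ∫⁻ ω, (a + (separatedCentres c M N r)ᶜ.indicator 1 ω)
        ∂(Measure.pi fun _ : Fin N => Q) := lintegral_mono fun ω => ?_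
    _ = _ := by
      rw [lintegral_add_left measurable_const, lintegral_const, measure_univ, mul_one,
        lintegral_indicator_one hS]
  have hprob := isProbabilityMeasure_ballMixture hN hr ω
  let P : ProbabilityMeasure (Obs dX dY dZ) := ⟨ballMixture r ω, hprob⟩
  have hdens : Measurable fun x => (N : ℝ≥0∞)⁻¹ * ∑ j, ballDensity r (ω j) x :=
    (Finset.measurable_sum _ fun j _ => (measurable_ballDensity r).of_uncurry_left).const_mul _
  have hmix := ballMixture_eq_withDensity r ω
  have hprob' : IsProbabilityMeasure (volume.withDensity
      fun x => (N : ℝ≥0∞)⁻¹ * ∑ j, ballDensity r (ω j) x) := hmix ▸ hprob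
  have h2 : ∫⁻ x, ψ.condRejectionProb x * ∏ i, ((N : ℝ≥0∞)⁻¹ * ∑ j, ballDensity r (ω j) (x i))
      ∂(Measure.pi fun _ : Fin n => volume) = ψ.rejectionProb P := by
    rw [← lintegral_pi_withDensity volume _ hdens _ ψ.measurable_condRejectionProb,
      ψ.rejectionProb_eq_lintegral, ← hmix]
    rfl
  rw [h2]
  -- Separated centres give a null law, where the level applies; otherwise the trivial bound `1` is
  -- paid by the indicator.
  by_cases hω : ω ∈ separatedCentres c M N r
  · exact (hψ _ (ballMixture_mem_nullLaws c M hN hr ω hω)).trans le_self_add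
  · rw [Set.indicator_of_mem (show ω ∈ (separatedCentres c M N r)ᶜ from hω)]
    exact le_add_left (ψ.rejectionProb_le_one P)

lemma rejectionProb_le_liminf (ψ : RandomisedTest dX dY dZ n)
    (Q : ProbabilityMeasure (Obs dX dY dZ)) (hQ : (Q : Measure (Obs dX dY dZ)) ≪ volume)
    {r : ℕ → ℝ} (hr : Tendsto r atTop (𝓝[>] 0)) :
    ψ.rejectionProb Q ≤ liminf (fun k => ∫⁻ x, ψ.condRejectionProb x *
      ∏ i, ((Q : Measure (Obs dX dY dZ)) (closedBall (x i) (r k)) / volume (closedBall (x i) (r k)))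
        ∂(Measure.pi fun _ : Fin n => volume)) atTop := by
  have hd := Measure.withDensity_rnDeriv_eq (Q : Measure (Obs dX dY dZ)) volume hQ
  have hf : Measurable ((Q : Measure (Obs dX dY dZ)).rnDeriv volume) :=
    Measure.measurable_rnDeriv _ _
  have hprob : IsProbabilityMeasure ((volume : Measure (Obs dX dY dZ)).withDensity
      ((Q : Measure (Obs dX dY dZ)).rnDeriv volume)) := by
    rw [hd]; infer_instance
  have h1 : ψ.rejectionProb Q = ∫⁻ x, ψ.condRejectionProb x *
      ∏ i, (Q : Measure (Obs dX dY dZ)).rnDeriv volume (x i)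
        ∂(Measure.pi fun _ : Fin n => volume) := by
    rw [← lintegral_pi_withDensity volume _ hf _ ψ.measurable_condRejectionProb,
      ψ.rejectionProb_eq_lintegral, hd]
  rw [h1]
  -- Fatou needs no domination, and a lower bound on the smoothed probabilities suffices.
  refine le_trans (lintegral_mono_ae ?_) (lintegral_liminf_le fun k => ?_)
  · have h2 : ∀ᵐ x ∂(Measure.pi fun _ : Fin n => (volume : Measure (Obs dX dY dZ))), ∀ i,
        Tendsto (fun ρ => (Q : Measure (Obs dX dY dZ)) (closedBall (x i) ρ) /
          volume (closedBall (x i) ρ)) (𝓝[>] 0)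
          (𝓝 ((Q : Measure (Obs dX dY dZ)).rnDeriv volume (x i))) ∧
        (Q : Measure (Obs dX dY dZ)).rnDeriv volume (x i) < ∞ := by
      refine ae_all_iff.2 fun i => ?_
      exact (Measure.tendsto_eval_ae_ae (μ := fun _ : Fin n => (volume : Measure (Obs dX dY dZ)))
        (i := i)).eventually ((Besicovitch.ae_tendsto_rnDeriv _ _).and
          (Measure.rnDeriv_lt_top (Q : Measure (Obs dX dY dZ)) volume))
    filter_upwards [h2] with x hx
    refine (Tendsto.liminf_eq ?_).ge
    refine ENNReal.Tendsto.const_mul (ENNReal.tendsto_finsetProd_of_ne_top _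
      (fun i _ => (hx i).1.comp hr) fun i _ => (hx i).2.ne) (Or.inr ?_)
    exact (prob_le_one.trans_lt ENNReal.one_lt_top).ne
  · exact ψ.measurable_condRejectionProb.mul (Finset.measurable_prod _ fun i _ =>
      (measurable_measure_closedBall_div _ _).comp (measurable_pi_apply i))

/-- For fixed `n`, draws from `N` components are distinct with probability tending to `1`. -/
lemma tendsto_descFactorial_mul_inv_pow (n : ℕ) :
    Tendsto (fun N : ℕ => (N.descFactorial n : ℝ≥0∞) * (N : ℝ≥0∞)⁻¹ ^ n) atTop (𝓝 1) := by
  have h1 : Tendsto (fun N : ℕ => (N.descFactorial n : ℝ) / (N : ℝ) ^ n) atTop (𝓝 1) := by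
    refine (Asymptotics.isEquivalent_iff_tendsto_one ?_).1 (isEquivalent_descFactorial n)
    filter_upwards [eventually_gt_atTop 0] with N hN
    positivity
  have h2 := ENNReal.tendsto_ofReal h1
  rw [ENNReal.ofReal_one] at h2
  refine h2.congr' ?_
  filter_upwards [eventually_gt_atTop 0] with N hN
  rw [ENNReal.ofReal_div_of_pos (by positivity), ENNReal.ofReal_natCast,
    ENNReal.ofReal_pow (by positivity), ENNReal.ofReal_natCast, ENNReal.div_eq_inv_mul,
    ENNReal.inv_pow, mul_comm]

end Power

theorem theorem1 {dX dY dZ : ℕ} (hX : 0 < dX) (hY : 0 < dY) (hZ : 0 < dZ)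
    (n : ℕ) (α : ℝ) (hα : α ∈ Set.Ioo (0 : ℝ) 1) (c : Obs dX dY dZ) (M : ℝ≥0∞) (hM : 0 < M)
    (ψ : RandomisedTest dX dY dZ n) (hψ : ψ.HasValidLevel (nullLaws dX dY dZ c M) α) :
    ∀ Q ∈ altLaws dX dY dZ c M, ψ.rejectionProb Q ≤ ENNReal.ofReal α := by
  intro Q hQ
  have hlevel : ∀ P ∈ nullLaws dX dY dZ c M, ψ.rejectionProb P ≤ ENNReal.ofReal α :=
    fun P hP => (le_iSup₂ (f := fun P _ => ψ.rejectionProb P) P hP).trans hψ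
  have hr : Filter.Tendsto (fun k : ℕ => 1 / ((k : ℝ) + 1)) Filter.atTop
      (nhdsWithin 0 (Set.Ioi 0)) :=
    tendsto_nhdsWithin_iff.2 ⟨tendsto_one_div_add_atTop_nhds_zero_nat,
      Filter.Eventually.of_forall fun k => by simp only [Set.mem_Ioi]; positivity⟩
  -- `N` stays fixed while `r → 0`: how small `r` must be for separation depends on `N`.
  have hbound : ∀ N : ℕ, 0 < N → (N.descFactorial n : ℝ≥0∞) * (N : ℝ≥0∞)⁻¹ ^ n *
      ψ.rejectionProb Q ≤ ENNReal.ofReal α := by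
    intro N hN
    have hbad := tendsto_measure_compl_separatedCentres hZ c M hQ.1.1 hQ.1.2 N
      tendsto_one_div_add_atTop_nhds_zero_nat
    have hlim := (tendsto_const_nhds (x := ENNReal.ofReal α)).add hbad
    rw [add_zero] at hlim
    have hfin : (N.descFactorial n : ℝ≥0∞) * (N : ℝ≥0∞)⁻¹ ^ n ≠ ∞ :=
      ENNReal.mul_ne_top (ENNReal.natCast_ne_top _)
        (ENNReal.pow_ne_top (ENNReal.inv_ne_top.2 (Nat.cast_ne_zero.2 hN.ne')))
    calc _ ≤ (N.descFactorial n : ℝ≥0∞) * (N : ℝ≥0∞)⁻¹ ^ n * _ :=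
          mul_le_mul_right (rejectionProb_le_liminf ψ Q hQ.1.1 hr) _
      _ = _ := (ENNReal.liminf_const_mul_of_ne_top hfin).symm
      _ ≤ _ := Filter.liminf_le_liminf (Filter.Eventually.of_forall fun k =>
          descFactorial_mul_lintegral_le c M ψ hlevel (Q : Measure (Obs dX dY dZ)) hN
            (r := 1 / ((k : ℝ) + 1)) (by positivity))
      _ = ENNReal.ofReal α := hlim.liminf_eq
  have hD := ENNReal.Tendsto.mul_const (tendsto_descFactorial_mul_inv_pow n)
    (b := ψ.rejectionProb Q) (Or.inl one_ne_zero)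
  rw [one_mul] at hD
  refine le_of_tendsto hD ?_
  filter_upwards [Filter.eventually_gt_atTop 0] with N hN
  exact hbound N hN
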